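/- Let $d\ge 1$, let $\mathbb R^d$ carry a fixed norm with metric $d(\cdot,\cdot)$, and let $r\in(0,\infty)$. For a Borel probability measure $P$ on $\mathbb R^d$ and $n\in\mathbb N$ put $$V_{n,r}(P)=\inf\Big\{\int d(x,\alpha)^r\,dP(x):\alpha\subset\mathbb R^d,\ \operatorname{card}(\alpha)\le n\Big\},$$ $$\underline D_r(P)=\liminf_{n\to\infty}\frac{r\log n}{-\log V_{n,r}(P)},\qquad \overline D_r(P)=\limsup_{n\to\infty}\frac{r\log n}{-\log V_{n,r}(P)},$$ the quotient being $0$ where $V_{n,r}(P)=0$. Let $N\ge 1$, let $S_1,\dots,S_N:\mathbb R^d\to\mathbb R^d$ satisfy $s_i\,d(x,y)\le d(S_i(x),S_i(y))\le c_i\,d(x,y)$ for all $x,y$, where $0<s_i\le c_i<1$; let $(p_0,p_1,\dots,p_N)$ be a probability vector with all $p_i>0$; let $C\subset\mathbb R^d$ be compact and let $\nu$ be a Borel probability measure with $\nu(C)=1$. Let $\mu$ be the condensation measure of this system, that is, the Borel probability measure with $\mu=p_0\nu+\sum_{i=1}^N p_i\,\mu\circ S_i^{-1}$, and let $K$ be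 the compact set with $K=\bigcup_{i=1}^N S_i(K)\cup C$. Assume the strong separation condition: $S_1(K),\dots,S_N(K),C$ are pairwise disjoint. (a) There is a unique $k_r\in[0,\infty)$ with $\sum_{i=1}^N(p_is_i^r)^{\frac{k_r}{r+k_r}}=1$, and $$\max\{k_r,\underline D_r(\nu)\}\le\underline D_r(\mu).$$ (b) Suppose moreover that $\nu=\sum_{j=1}^M t_j\,\nu\circ g_j^{-1}$, where $(t_1,\dots,t_M)$ is a probability vector with all $t_j>0$ and $g_1,\dots,g_M:\mathbb R^d\to\mathbb R^d$ satisfy $d(g_j(x),g_j(y))\le r_j\,d(x,y)$ for all $x,y$, with $0<r_j<1$, together with the strong open set condition: there is a bounded nonempty open set $U$ with $g_j(U)\subseteq U$ for all $j$, $g_i(U)\cap g_j(U)=\emptyset$ for $i\ne j$, and $U\cap A\neq\emptyset$, where $A$ is the nonempty compact set with $A=\bigcup_j g_j(A)$. Then there are unique $l_r,d_r\in[0,\infty)$ with $\sum_{i=1}^N(p_ic_i^r)^{\frac{l_r}{r+l_r}}=1$ and $\sum_{j=1}^M(t_jr_j^r)^{\frac{d_r}{r+d_r}}=1$, and $$\overline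 D_r(\mu)\le\max\{l_r,d_r\}.$$ -/

import Mathlib

open MeasureTheory Filter
open scoped ENNReal

noncomputable section

namespace CondQuant

variable {E : Type*} [NormedAddCommGroup E]

/-- The `n`th quantization error of order `r` of `P`: the infimum of `∫ d(x, α) ^ r dP(x)` over all
sets `α` with at most `n` points. The distance to the empty set is `∞`, so that (for `r > 0` and
`P ≠ 0`) the empty set never competes. -/
def quantError [MeasurableSpace E] (r : ℝ) (P : Measure E) (n : ℕ) : ℝ≥0∞ :=
  ⨅ (α : Finset E) (_ : α.card ≤ n), ∫⁻ x, (Metric.infEDist x (α : Set E)) ^ r ∂P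

/-- The quotient `r log n / (- log V_{n,r}(P))`. If `V_{n,r}(P) = 0`, so that `- log V_{n,r}(P) = ∞`,
its value is `0`. -/
def quantRatio [MeasurableSpace E] (r : ℝ) (P : Measure E) (n : ℕ) : ℝ :=
  r * Real.log n / (-Real.log (quantError r P n).toReal)

/-- The lower quantization dimension of order `r`. -/
def lowerQuantDim [MeasurableSpace E] (r : ℝ) (P : Measure E) : EReal :=
  liminf (fun n : ℕ => (quantRatio r P n : EReal)) atTop

/-- The upper quantization dimension of order `r`. -/
def upperQuantDim [MeasurableSpace E] (r : ℝ) (P : Measure E) : EReal :=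
  limsup (fun n : ℕ => (quantRatio r P n : EReal)) atTop

/-- A probability vector with positive entries. -/
def IsProbVector {ι : Type*} [Fintype ι] (p : ι → ℝ) : Prop :=
  (∀ i, 0 < p i) ∧ ∑ i, p i = 1

/-- `μ = p₀ ν + ∑ pᵢ μ ∘ Sᵢ⁻¹`, where `p = (p₀, p₁, …, p_N)`. -/
def IsCondensationMeasure [MeasurableSpace E] {N : ℕ} (S : Fin N → E → E) (p : Fin (N + 1) → ℝ)
    (ν μ : Measure E) : Prop :=
  μ = ENNReal.ofReal (p 0) • ν + ∑ i : Fin N, ENNReal.ofReal (p i.succ) • μ.map (S i)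

/-- `ν = ∑ tⱼ ν ∘ gⱼ⁻¹`. -/
def IsInvariantMeasure [MeasurableSpace E] {M : ℕ} (g : Fin M → E → E) (t : Fin M → ℝ)
    (ν : Measure E) : Prop :=
  ν = ∑ j : Fin M, ENNReal.ofReal (t j) • ν.map (g j)

/-- `K` is the attractor of the system with maps `Sᵢ` and condensation set `C`: the compact set
with `K = ⋃ Sᵢ(K) ∪ C` (unique for contractions `Sᵢ` and a nonempty compact `C`). -/
def IsCondensationAttractor {N : ℕ} (S : Fin N → E → E) (C K : Set E) : Prop :=
  IsCompact K ∧ K = (⋃ i, S i '' K) ∪ C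

/-- The strong separation condition: `S₁(K), …, S_N(K)` and `C` are pairwise disjoint, where `K` is
the attractor of the condensation system. -/
def StrongSeparation {N : ℕ} (S : Fin N → E → E) (C : Set E) : Prop :=
  ∃ K, IsCondensationAttractor S C K ∧
    (∀ i j, i ≠ j → Disjoint (S i '' K) (S j '' K)) ∧ ∀ i, Disjoint (S i '' K) C

/-- `A` is the attractor of the iterated function system `g`. -/
def IsAttractor {M : ℕ} (g : Fin M → E → E) (A : Set E) : Prop :=
  A.Nonempty ∧ IsCompact A ∧ A = ⋃ j, g j '' A

/-- The strong open set condition: the open set condition holds with an open set that meets the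
attractor. -/
def StrongOpenSetCondition {M : ℕ} (g : Fin M → E → E) : Prop :=
  ∃ U : Set E, IsOpen U ∧ Bornology.IsBounded U ∧ U.Nonempty ∧
    (∀ j, g j '' U ⊆ U) ∧ (∀ i j, i ≠ j → Disjoint (g i '' U) (g j '' U)) ∧
    ∃ A, IsAttractor g A ∧ (U ∩ A).Nonempty

/-- `k ≥ 0` solves `∑ (pᵢ aᵢ ^ r) ^ (k / (r + k)) = 1`. -/
def IsDimSolution {N : ℕ} (r : ℝ) (p a : Fin N → ℝ) (k : ℝ) : Prop :=
  0 ≤ k ∧ ∑ i, (p i * a i ^ r) ^ (k / (r + k)) = 1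

end CondQuant

end

open MeasureTheory Filter
open scoped ENNReal

namespace CondQuant

/-! ### The dimension equation -/

/-! Follow the copies `w • μ.map T` of `μ`, with `T` a composition of the `S i`, `w` the product of
their weights and `σ` that of their ratios. The size of a copy is `w σ ^ r`; subdivision stops once
it drops below `ε`, so the final sizes are comparable to `ε`.

Lower bound (`le_lintegral_piece`): for `q = k / (r + k)`, subdivision preserves the sum of `size ^
q`, so about `ε ^ (-q)` copies are final. By separation a point of `α` is near at most one of them,
and a copy with no near point costs at least a constant times `ε`. Taking `ε ^ (-q) = 2 n` leaves
`n` such copies. The bound by the dimension of `ν` comes from `p₀ ν ≤ μ`.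

Upper bound (`HasQuantizers.of_eq_add_sum`): one point serves each final copy of `μ`, and each
intermediate copy of `ν` is quantized at the same scale `ε`. For `D > max l d` and `Q = D / (r + D)`
the sums of `Q`-th powers are below one, so the counts and the errors over all levels form a
convergent geometric series. The same lemma, with no condensation part, first quantizes `ν`. -/

lemma exponent_strictMono {r k l : ℝ} (hr : 0 < r) (hk : 0 ≤ k) (hkl : k < l) :
    k / (r + k) < l / (r + l) := by
  rw [div_lt_div_iff₀ (by linarith) (by linarith)]
  nlinarith

lemma sum_rpow_strictAnti {N : ℕ} (hN : 1 ≤ N) {b : Fin N → ℝ} (hb0 : ∀ i, 0 < b i)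
    (hb1 : ∀ i, b i < 1) {q q' : ℝ} (h : q < q') : ∑ i, b i ^ q' < ∑ i, b i ^ q := by
  have : Nonempty (Fin N) := ⟨⟨0, hN⟩⟩
  exact Finset.sum_lt_sum_of_nonempty Finset.univ_nonempty
    fun i _ => Real.rpow_lt_rpow_of_exponent_gt (hb0 i) (hb1 i) h

lemma weight_pos {r p a : ℝ} (hp : 0 < p) (ha : 0 < a) : 0 < p * a ^ r :=
  mul_pos hp (Real.rpow_pos_of_pos ha r)

lemma weight_lt {r p a : ℝ} (hr : 0 < r) (hp : 0 < p) (ha : 0 < a) (ha1 : a < 1) :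
    p * a ^ r < p :=
  mul_lt_of_lt_one_right hp (Real.rpow_lt_one ha.le ha1 hr)

/-- The map `k ↦ k / (r + k)` is a bijection from `[0, ∞)` onto `[0, 1)`. In the variable `q = k /
(r + k)` the sum is continuous and strictly decreasing, equal to `N ≥ 1` at `q = 0` and below one at
`q = 1`. -/
lemma existsUnique_isDimSolution {N : ℕ} (hN : 1 ≤ N) {r : ℝ} (hr : 0 < r) {p a : Fin N → ℝ}
    (hp : ∀ i, 0 < p i) (hp1 : ∑ i, p i ≤ 1) (ha : ∀ i, 0 < a i) (ha1 : ∀ i, a i < 1) :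
    ∃! k : ℝ, IsDimSolution r p a k := by
  have hb0 : ∀ i, 0 < p i * a i ^ r := fun i => weight_pos (hp i) (ha i)
  have hbp : ∀ i, p i * a i ^ r < p i := fun i => weight_lt hr (hp i) (ha i) (ha1 i)
  have hb1 : ∀ i, p i * a i ^ r < 1 := fun i => (hbp i).trans_le
    ((Finset.single_le_sum (fun j _ => (hp j).le) (Finset.mem_univ i)).trans hp1)
  have : Nonempty (Fin N) := ⟨⟨0, hN⟩⟩
  have hsum : ∑ i, p i * a i ^ r < 1 :=
    (Finset.sum_lt_sum_of_nonempty Finset.univ_nonempty fun i _ => hbp i).trans_le hp1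
  have hcont : ContinuousOn (fun q : ℝ => ∑ i, (p i * a i ^ r) ^ q) (Set.Icc 0 1) := by
    refine (continuous_finsetSum _ fun i _ => ?_).continuousOn
    exact Real.continuous_const_rpow (hb0 i).ne'
  have hmem : (1 : ℝ) ∈ Set.Icc (∑ i, (p i * a i ^ r) ^ (1 : ℝ)) (∑ i, (p i * a i ^ r) ^ (0 : ℝ)) := by
    constructor
    · simpa using hsum.le
    · simpa using hN
  obtain ⟨q, ⟨hq0, hq1⟩, hq⟩ := intermediate_value_Icc' zero_le_one hcont hmem
  have hq1' : q < 1 := by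
    rcases hq1.lt_or_eq with h | h
    · exact h
    · subst h
      simp only [Real.rpow_one] at hq
      linarith
  refine ⟨r * q / (1 - q), ⟨div_nonneg (by positivity) (by linarith), ?_⟩, ?_⟩
  · have : r * q / (1 - q) / (r + r * q / (1 - q)) = q := by
      have h1 : 1 - q ≠ 0 := by linarith
      field_simp
      ring
    simpa only [this] using hq
  · rintro k ⟨hk0, hk⟩
    have key : k / (r + k) = q := by
      rcases lt_trichotomy (k / (r + k)) q with h | h | h
      · have := sum_rpow_strictAnti hN hb0 hb1 h
        simp only at hq
        linarith
      · exact h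
      · have := sum_rpow_strictAnti hN hb0 hb1 h
        simp only at hq
        linarith
    have h1 : 1 - q ≠ 0 := by linarith
    have h2 : r + k ≠ 0 := by linarith
    rw [div_eq_iff h2] at key
    rw [eq_div_iff h1]
    linarith

/-! ### Quantization dimensions from bounds on the quantization error -/

section Dim
variable {E : Type*} [NormedAddCommGroup E] [MeasurableSpace E] {r : ℝ} {P : Measure E}

lemma tendsto_log_natCast : Tendsto (fun n : ℕ => Real.log n) atTop atTop :=
  Real.tendsto_log_atTop.comp tendsto_natCast_atTop_atTop

/-- The constant `b` is negligible against `log n`, at the price of passing to `z < x`. Positivity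
of the error excludes the default value `0` of the quotient. -/
lemma le_lowerQuantDim (hr : 0 < r) (h1 : ∀ᶠ n in atTop, (quantError r P n).toReal < 1) {x b : ℝ}
    (h : ∀ᶠ n : ℕ in atTop, 0 < (quantError r P n).toReal ∧
      x * -Real.log (quantError r P n).toReal ≤ r * Real.log n + b) :
    (x : EReal) ≤ lowerQuantDim r P := by
  refine EReal.ge_of_forall_gt_iff_ge.1 fun z hz => ?_
  have hz : z < x := by exact_mod_cast hz
  refine le_liminf_of_le (by isBoundedDefault) ?_
  have hlog : ∀ᶠ n : ℕ in atTop, max 0 (z * b) ≤ (x - z) * (r * Real.log n) :=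
    ((tendsto_log_natCast.const_mul_atTop hr).const_mul_atTop (sub_pos.2 hz)).eventually_ge_atTop _
  filter_upwards [h1, h, hlog, eventually_ge_atTop 1] with n hn1 ⟨hn0, hn⟩ hnl hn2
  rw [EReal.coe_le_coe_iff, quantRatio]
  have hpos : 0 < -Real.log (quantError r P n).toReal := by
    have := Real.log_neg hn0 hn1
    linarith
  rw [le_div_iff₀ hpos]
  have hL : 0 ≤ r * Real.log n :=
    mul_nonneg hr.le (Real.log_nonneg (by exact_mod_cast hn2))
  rcases le_or_gt z 0 with hz0 | hz0
  · nlinarith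
  · have hx : 0 < x := hz0.trans hz
    have h3 := le_trans (le_max_right 0 (z * b)) hnl
    have h4 : x * (z * -Real.log (quantError r P n).toReal) ≤ x * (r * Real.log n) := by
      nlinarith [mul_le_mul_of_nonneg_left hn hz0.le]
    exact le_of_mul_le_mul_left h4 hx

lemma upperQuantDim_le {D B : ℝ} (hD : 0 < D) (hr : 0 < r) (hB : 0 < B)
    (h : ∀ᶠ n : ℕ in atTop, (quantError r P n).toReal ≤ B * (n : ℝ) ^ (-(r / D))) :
    upperQuantDim r P ≤ D := by
  refine EReal.le_of_forall_lt_iff_le.1 fun z hz => ?_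
  have hz : D < z := by exact_mod_cast hz
  refine limsup_le_of_le (by isBoundedDefault) ?_
  -- The slack `z / D > 1` absorbs `log B`; the extra `1` later forces `-log V > 0`.
  have hlog : ∀ᶠ n : ℕ in atTop, max 1 (z * Real.log B + 1) ≤ (z / D - 1) * (r * Real.log n) :=
    ((tendsto_log_natCast.const_mul_atTop hr).const_mul_atTop
      (by rw [sub_pos, lt_div_iff₀ hD]; linarith)).eventually_ge_atTop _
  filter_upwards [h, hlog, eventually_ge_atTop 1] with n hn hnl hn2
  rw [EReal.coe_le_coe_iff, quantRatio]
  have hn0 : (0 : ℝ) < n := by exact_mod_cast hn2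
  rcases (ENNReal.toReal_nonneg (a := quantError r P n)).eq_or_lt with h0 | h0
  -- If `toReal` vanishes, the quotient is `0`.
  · rw [← h0]; simp; linarith
  have hl := Real.log_le_log h0 hn
  rw [Real.log_mul hB.ne' (by positivity), Real.log_rpow hn0] at hl
  have hL : 0 ≤ r * Real.log n :=
    mul_nonneg hr.le (Real.log_nonneg (by exact_mod_cast hn2))
  have hz0 : 0 < z := hD.trans hz
  have h1 := le_trans (le_max_right _ _) hnl
  have h2 : r * Real.log n + 1 ≤ z * -Real.log (quantError r P n).toReal := by
    have := mul_le_mul_of_nonneg_left hl hz0.le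
    have e : z * (-(r / D) * Real.log n) = - (z / D * (r * Real.log n)) := by ring
    nlinarith
  have hpos : 0 < -Real.log (quantError r P n).toReal := by
    by_contra hcon
    nlinarith
  rw [div_le_iff₀ hpos]
  linarith

end Dim

/-! ### Elementary facts on quantization errors and integrals -/

section Basic
variable {E : Type*} [NormedAddCommGroup E] [MeasurableSpace E] {r : ℝ}

lemma quantError_le_lintegral (P : Measure E) {n : ℕ} {α : Finset E} (h : α.card ≤ n) :
    quantError r P n ≤ ∫⁻ x, (Metric.infEDist x (α : Set E)) ^ r ∂P :=
  iInf₂_le α h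

lemma smul_quantError_le {ν μ : Measure E} {a : ℝ≥0∞} (h : a • ν ≤ μ) (n : ℕ) :
    a * quantError r ν n ≤ quantError r μ n := by
  refine le_iInf₂ fun α hα => ?_
  calc a * quantError r ν n ≤ a * ∫⁻ x, (Metric.infEDist x (α : Set E)) ^ r ∂ν := by
        gcongr; exact quantError_le_lintegral ν hα
    _ = ∫⁻ x, (Metric.infEDist x (α : Set E)) ^ r ∂(a • ν) := by rw [lintegral_smul_measure, smul_eq_mul]
    _ ≤ _ := lintegral_mono' h le_rfl

/-- A measure concentrated on a compact set has quantization errors eventually below one. -/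
lemma eventually_quantError_lt_one (hr : 0 < r) {P : Measure E} [IsProbabilityMeasure P] {K : Set E}
    (hK : IsCompact K) (hPK : ∀ᵐ x ∂P, x ∈ K) :
    ∀ᶠ n in atTop, (quantError r P n).toReal < 1 := by
  obtain ⟨t, -, htf, ht⟩ := hK.finite_cover_balls (e := 1 / 2) (by norm_num)
  lift t to Finset E using htf
  filter_upwards [eventually_ge_atTop t.card] with n hn
  have h : quantError r P n ≤ (ENNReal.ofReal (1 / 2)) ^ r := by
    refine (quantError_le_lintegral P hn).trans ?_
    calc ∫⁻ x, (Metric.infEDist x (t : Set E)) ^ r ∂P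
        ≤ ∫⁻ _, (ENNReal.ofReal (1 / 2)) ^ r ∂P := by
          refine lintegral_mono_ae ?_
          filter_upwards [hPK] with x hx
          obtain ⟨y, hy, hxy⟩ := Set.mem_iUnion₂.1 (ht hx)
          refine ENNReal.rpow_le_rpow ((Metric.infEDist_le_edist_of_mem hy).trans ?_) hr.le
          rw [edist_dist]
          exact ENNReal.ofReal_le_ofReal (Metric.mem_ball.1 hxy).le
      _ = _ := by simp
  have h2 : (ENNReal.ofReal (1 / 2)) ^ r < 1 :=
    ENNReal.rpow_lt_one (by rw [ENNReal.ofReal_lt_one]; norm_num) hr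
  exact ENNReal.toReal_lt_of_lt_ofReal (by simpa using h.trans_lt h2)

variable [BorelSpace E]

lemma measurable_infEDist_comp_rpow {T : E → E} (hT : Continuous T) (α : Finset E) :
    Measurable fun x => (Metric.infEDist (T x) (α : Set E)) ^ r :=
  ((Metric.continuous_infEDist.comp hT).measurable).pow_const r

lemma lintegral_of_eq_add_sum {N : ℕ} {S : Fin N → E → E} (hS : ∀ i, Continuous (S i))
    {p : Fin N → ℝ} {m₀ m : Measure E}
    (hm : m = m₀ + ∑ i, ENNReal.ofReal (p i) • m.map (S i)) {f : E → ℝ≥0∞} (hf : Measurable f) :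
    ∫⁻ x, f x ∂m = ∫⁻ x, f x ∂m₀ + ∑ i, ENNReal.ofReal (p i) * ∫⁻ x, f (S i x) ∂m := by
  have h := congrArg (fun m' => ∫⁻ x, f x ∂m') hm
  simp only [lintegral_add_measure, lintegral_finsetSum_measure, lintegral_smul_measure,
    smul_eq_mul] at h
  rw [h]
  congr 1
  exact Finset.sum_congr rfl fun i _ => by rw [lintegral_map hf (hS i).measurable]

/-- A condensation measure is concentrated on the attractor. -/
lemma ae_mem_attractor {N : ℕ} {S : Fin N → E → E} (hS : ∀ i, Continuous (S i))
    {p : Fin (N + 1) → ℝ} (hp : IsProbVector p) {C K : Set E}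
    {ν μ : Measure E} [IsProbabilityMeasure μ] (hν : ∀ᵐ x ∂ν, x ∈ C)
    (hμ : IsCondensationMeasure S p ν μ) (hK : IsCondensationAttractor S C K) :
    ∀ᵐ x ∂μ, x ∈ K := by
  obtain ⟨hKc, hKeq⟩ := hK
  have hmeas : MeasurableSet Kᶜ := hKc.isClosed.measurableSet.compl
  have hν0 : ν Kᶜ = 0 := by
    change ∀ᵐ x ∂ν, x ∈ K
    filter_upwards [hν] with x hx
    rw [hKeq]; exact Or.inr hx
  -- Since `S i` maps `K` into `K`, the preimage of `Kᶜ` lies in `Kᶜ`, and `ν` does not charge `Kᶜ`.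
  -- As `1 - p 0 < 1`, the mass of `Kᶜ` is zero.
  have h1 : μ Kᶜ ≤ ENNReal.ofReal (1 - p 0) * μ Kᶜ := by
    have h := congrArg (fun m : Measure E => m Kᶜ) hμ
    simp only [Measure.add_apply, Measure.smul_apply, Measure.coe_finsetSum, Finset.sum_apply,
      smul_eq_mul, hν0, mul_zero, zero_add] at h
    have hp1 : 1 - p 0 = ∑ i : Fin N, p i.succ := by
      rw [← hp.2, Fin.sum_univ_succ]; ring
    rw [hp1, ENNReal.ofReal_sum_of_nonneg fun i _ => (hp.1 _).le, Finset.sum_mul]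
    nth_rewrite 1 [h]
    refine Finset.sum_le_sum fun i _ => ?_
    rw [Measure.map_apply (hS i).measurable hmeas]
    gcongr
    intro x hx hxK
    refine hx ?_
    rw [hKeq]
    exact Or.inl (Set.mem_iUnion.2 ⟨i, x, hxK, rfl⟩)
  change μ Kᶜ = 0
  by_contra h0
  have hlt : ENNReal.ofReal (1 - p 0) * μ Kᶜ < 1 * μ Kᶜ := by
    refine ENNReal.mul_lt_mul_left h0 (measure_ne_top _ _) ?_
    rw [ENNReal.ofReal_lt_one]
    linarith [hp.1 0]
  rw [one_mul] at hlt
  exact absurd h1 (not_le.2 hlt)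

end Basic

/-! ### The lower bound -/

section Lower
variable {E : Type*} [NormedAddCommGroup E]

lemma exists_pos_le_of_pos {N : ℕ} {b : Fin N → ℝ} (hb : ∀ i, 0 < b i) {η : ℝ} (hη : 0 < η) :
    ∃ η' > 0, η' ≤ η ∧ ∀ i, η' ≤ b i := by
  have h : ∀ᶠ x : ℝ in nhdsWithin 0 (Set.Ioi 0), x ≤ η ∧ ∀ i, x ≤ b i :=
    nhdsWithin_le_nhds ((eventually_le_nhds hη).and
      (eventually_all.2 fun i => eventually_le_nhds (hb i)))
  obtain ⟨x, ⟨h1, h2⟩, h3⟩ := (h.and self_mem_nhdsWithin).exists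
  exact ⟨x, h3, h1, h2⟩

lemma exists_lt_one_of_lt_one {N : ℕ} {b : Fin N → ℝ} (hb : ∀ i, b i < 1) :
    ∃ A, 0 < A ∧ A < 1 ∧ ∀ i, b i ≤ A := by
  obtain ⟨e, he, he1, h⟩ := exists_pos_le_of_pos (fun i => sub_pos.2 (hb i)) one_half_pos
  exact ⟨1 - e, by linarith, by linarith, fun i => by linarith [h i]⟩

lemma exists_forall_le_dist {N : ℕ} {F : Fin N → Set E} (hF : ∀ i, IsCompact (F i))
    (hd : ∀ i j, i ≠ j → Disjoint (F i) (F j)) :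
    ∃ δ > 0, ∀ i j, i ≠ j → ∀ x ∈ F i, ∀ y ∈ F j, δ ≤ dist x y := by
  have h : ∀ i j, ∃ e : ℝ, 0 < e ∧ (i ≠ j → ∀ x ∈ F i, ∀ y ∈ F j, e ≤ dist x y) := by
    intro i j
    by_cases hij : i = j
    · exact ⟨1, one_pos, fun h => absurd hij h⟩
    obtain ⟨e, he, h⟩ :=
      Metric.exists_pos_forall_lt_edist (hF i) (hF j).isClosed (hd i j hij)
    refine ⟨e, he, fun _ x hx y hy => ?_⟩
    have := h x hx y hy
    rw [edist_nndist] at this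
    exact_mod_cast (ENNReal.coe_lt_coe.1 this).le
  choose e he h using h
  have h2 : ∀ i, ∃ δ > 0, δ ≤ 1 ∧ ∀ j, δ ≤ e i j := fun i => exists_pos_le_of_pos (he i) one_pos
  choose δ hδ _ h2 using h2
  obtain ⟨x, hx, _, h3⟩ := exists_pos_le_of_pos hδ one_pos
  exact ⟨x, hx, fun i j hij a ha b hb => ((h3 i).trans (h2 i j)).trans (h i j hij a ha b hb)⟩

lemma ofReal_sum_le {ι : Type*} (s : Finset ι) (f : ι → ℝ) :
    ENNReal.ofReal (∑ i ∈ s, f i) ≤ ∑ i ∈ s, ENNReal.ofReal (f i) := by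
  classical
  induction s using Finset.induction_on with
  | empty => simp
  | insert a s ha ih =>
    rw [Finset.sum_insert ha, Finset.sum_insert ha]
    exact ENNReal.ofReal_add_le.trans (by gcongr)

open scoped Classical in
/-- The points of `α` close to the image of `K` under `T`. -/
noncomputable def nearPoints (K : Set E) (α : Finset E) (T : E → E) (ρ : ℝ) : Finset E :=
  α.filter fun a => ∃ x ∈ K, dist a (T x) < ρ

lemma mem_nearPoints {K : Set E} {α : Finset E} {T : E → E} {ρ : ℝ} {a : E} :
    a ∈ nearPoints K α T ρ ↔ a ∈ α ∧ ∃ x ∈ K, dist a (T x) < ρ := by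
  classical
  simp [nearPoints]

/-- Points near the pieces `T (S i K)` can be counted separately. -/
lemma sum_card_nearPoints_le {N : ℕ} {S : Fin N → E → E} {s : Fin N → ℝ} (hs1 : ∀ i, s i < 1)
    {K : Set E} (hSK : ∀ i, ∀ x ∈ K, S i x ∈ K) {δ : ℝ} (hδ : 0 < δ)
    (hsep : ∀ i j, i ≠ j → ∀ x ∈ S i '' K, ∀ y ∈ S j '' K, δ ≤ dist x y)
    (α : Finset E) {T : E → E} {σ : ℝ} (hσ : 0 < σ)
    (hT : ∀ x y, σ * dist x y ≤ dist (T x) (T y)) :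
    ∑ i, (nearPoints K α (T ∘ S i) (δ * (σ * s i) / 2)).card
      ≤ (nearPoints K α T (δ * σ / 2)).card := by
  classical
  have hle : ∀ i, δ * (σ * s i) / 2 < δ * σ / 2 := fun i => by
    have : δ * σ * s i < δ * σ * 1 := mul_lt_mul_of_pos_left (hs1 i) (by positivity)
    linarith
  rw [← Finset.card_biUnion]
  · refine Finset.card_le_card fun a ha => ?_
    obtain ⟨i, -, ha⟩ := Finset.mem_biUnion.1 ha
    obtain ⟨haα, x, hx, hax⟩ := mem_nearPoints.1 ha
    exact mem_nearPoints.2 ⟨haα, S i x, hSK i x hx, hax.trans (hle i)⟩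
  · intro i _ j _ hij
    -- A common point would put two points at distance at least `δ * σ` both within less than `δ * σ
    -- / 2` of it.
    refine Finset.disjoint_left.2 fun a hai haj => ?_
    obtain ⟨-, x, hx, hax⟩ := mem_nearPoints.1 hai
    obtain ⟨-, y, hy, hay⟩ := mem_nearPoints.1 haj
    have h1 := hsep i j hij _ ⟨x, hx, rfl⟩ _ ⟨y, hy, rfl⟩
    have h2 := hT (S i x) (S j y)
    have h3 := dist_triangle_left (T (S i x)) (T (S j y)) a
    have h4 := mul_le_mul_of_nonneg_left h1 hσ.le
    simp only [Function.comp_apply] at hax hay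
    linarith [hle i, hle j]

variable [MeasurableSpace E] [BorelSpace E] {r : ℝ}

/-- The contribution of a piece of `μ` on which `α` has few points. -/
lemma le_lintegral_piece (hr : 0 < r) {N : ℕ} {S : Fin N → E → E} {s p : Fin N → ℝ}
    (hScont : ∀ i, Continuous (S i)) (hs : ∀ i, 0 < s i) (hs1 : ∀ i, s i < 1)
    (hS : ∀ i x y, s i * dist x y ≤ dist (S i x) (S i y)) (hp : ∀ i, 0 < p i)
    {K : Set E} (hSK : ∀ i, ∀ x ∈ K, S i x ∈ K) {δ : ℝ} (hδ : 0 < δ)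
    (hsep : ∀ i j, i ≠ j → ∀ x ∈ S i '' K, ∀ y ∈ S j '' K, δ ≤ dist x y)
    {m₀ μ : Measure E} [IsProbabilityMeasure μ] (hμK : ∀ᵐ x ∂μ, x ∈ K)
    (hμ : μ = m₀ + ∑ i, ENNReal.ofReal (p i) • μ.map (S i))
    {q : ℝ} (hq : 0 < q) (hsum : ∑ i, (p i * s i ^ r) ^ q = 1)
    {η : ℝ} (hη : 0 < η) (hηb : ∀ i, η ≤ p i * s i ^ r)
    {A : ℝ} (hA : 0 < A) (hbA : ∀ i, p i * s i ^ r ≤ A)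
    (α : Finset E) {ε : ℝ} (hε : 0 < ε) (m : ℕ) :
    ∀ {T : E → E} {σ w : ℝ}, Continuous T → 0 < σ → 0 < w →
      (∀ x y, σ * dist x y ≤ dist (T x) (T y)) → η * ε ≤ w * σ ^ r → w * σ ^ r * A ^ m < ε →
      ENNReal.ofReal ((δ / 2) ^ r * η * ε *
          ((w * σ ^ r / ε) ^ q - (nearPoints K α T (δ * σ / 2)).card))
        ≤ ENNReal.ofReal w * ∫⁻ x, (Metric.infEDist (T x) (α : Set E)) ^ r ∂μ := by
  -- Final copies: `(w σ ^ r / ε) ^ q ≤ 1`. With no near point, all of `T '' K` is at distance at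
  -- least `δ * σ / 2` from `α`; with one, the left side is `ofReal` of a nonpositive number.
  have small : ∀ {T : E → E} {σ w : ℝ}, Continuous T → 0 < σ → 0 < w →
      (∀ x y, σ * dist x y ≤ dist (T x) (T y)) → η * ε ≤ w * σ ^ r → w * σ ^ r < ε →
      ENNReal.ofReal ((δ / 2) ^ r * η * ε *
          ((w * σ ^ r / ε) ^ q - (nearPoints K α T (δ * σ / 2)).card))
        ≤ ENNReal.ofReal w * ∫⁻ x, (Metric.infEDist (T x) (α : Set E)) ^ r ∂μ := by
    intro T σ w hTc hσ hw hT h1 h2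
    have hσr : 0 < σ ^ r := Real.rpow_pos_of_pos hσ r
    have hle : (w * σ ^ r / ε) ^ q ≤ 1 :=
      Real.rpow_le_one (by positivity) ((div_le_one hε).2 h2.le) hq.le
    have hcoef : 0 ≤ (δ / 2) ^ r * η * ε := by positivity
    rcases (nearPoints K α T (δ * σ / 2)).eq_empty_or_nonempty with h0 | h0
    · have hbound : ENNReal.ofReal ((δ * σ / 2) ^ r)
          ≤ ∫⁻ x, (Metric.infEDist (T x) (α : Set E)) ^ r ∂μ := by
        calc ENNReal.ofReal ((δ * σ / 2) ^ r)
            = ∫⁻ _, ENNReal.ofReal ((δ * σ / 2) ^ r) ∂μ := by simp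
          _ ≤ _ := by
            refine lintegral_mono_ae ?_
            filter_upwards [hμK] with x hx
            rw [← ENNReal.ofReal_rpow_of_pos (by positivity)]
            refine ENNReal.rpow_le_rpow (Metric.le_infEDist.2 fun a ha => ?_) hr.le
            rw [edist_comm, edist_dist]
            refine ENNReal.ofReal_le_ofReal (not_lt.1 fun hlt => ?_)
            have : a ∈ nearPoints K α T (δ * σ / 2) := mem_nearPoints.2 ⟨ha, x, hx, hlt⟩
            simp [h0] at this
      calc _ ≤ ENNReal.ofReal (w * (δ * σ / 2) ^ r) := by
            refine ENNReal.ofReal_le_ofReal ?_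
            have e : (δ * σ / 2) ^ r = (δ / 2) ^ r * σ ^ r := by
              rw [← Real.mul_rpow (by positivity) hσ.le]; ring_nf
            rw [h0, e]
            simp only [Finset.card_empty, Nat.cast_zero, sub_zero]
            calc (δ / 2) ^ r * η * ε * (w * σ ^ r / ε) ^ q ≤ (δ / 2) ^ r * η * ε * 1 := by gcongr
              _ = (δ / 2) ^ r * (η * ε) := by ring
              _ ≤ (δ / 2) ^ r * (w * σ ^ r) := by gcongr
              _ = _ := by ring
        _ = ENNReal.ofReal w * ENNReal.ofReal ((δ * σ / 2) ^ r) := ENNReal.ofReal_mul hw.le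
        _ ≤ _ := by gcongr
    · have hc : (1 : ℝ) ≤ (nearPoints K α T (δ * σ / 2)).card := by
        exact_mod_cast Finset.card_pos.2 h0
      rw [ENNReal.ofReal_of_nonpos]
      · exact zero_le
      · exact mul_nonpos_of_nonneg_of_nonpos hcoef (by linarith)
  -- `m` bounds the remaining depth, since each subdivision multiplies the size by at most `A < 1`.
  induction m with
  | zero =>
    intro T σ w hTc hσ hw hT h1 h2
    exact small hTc hσ hw hT h1 (by simpa using h2)
  | succ m ih =>
    intro T σ w hTc hσ hw hT h1 h2
    rcases lt_or_ge (w * σ ^ r) ε with hlt | hge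
    · exact small hTc hσ hw hT h1 hlt
    have hσr : 0 < σ ^ r := Real.rpow_pos_of_pos hσ r
    have hcoef : 0 ≤ (δ / 2) ^ r * η * ε := by positivity
    have hwi : ∀ i, w * p i * (σ * s i) ^ r = w * σ ^ r * (p i * s i ^ r) := fun i => by
      rw [Real.mul_rpow hσ.le (hs i).le]; ring
    have hIH : ∀ i, ENNReal.ofReal ((δ / 2) ^ r * η * ε * ((w * p i * (σ * s i) ^ r / ε) ^ q -
          (nearPoints K α (T ∘ S i) (δ * (σ * s i) / 2)).card))
        ≤ ENNReal.ofReal (w * p i) *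
          ∫⁻ x, (Metric.infEDist ((T ∘ S i) x) (α : Set E)) ^ r ∂μ := by
      intro i
      refine ih (hTc.comp (hScont i)) (mul_pos hσ (hs i)) (mul_pos hw (hp i)) ?_ ?_ ?_
      · intro x y
        calc σ * s i * dist x y = σ * (s i * dist x y) := by ring
          _ ≤ σ * dist (S i x) (S i y) := by gcongr; exact hS i x y
          _ ≤ _ := hT _ _
      -- Only copies of size at least `ε` are split, so no child falls below `η * ε`.
      · rw [hwi, mul_comm η]
        exact mul_le_mul hge (hηb i) hη.le (by positivity)
      · rw [hwi]
        calc w * σ ^ r * (p i * s i ^ r) * A ^ m ≤ w * σ ^ r * A * A ^ m := by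
              gcongr; exact hbA i
          _ = w * σ ^ r * A ^ (m + 1) := by ring
          _ < ε := h2
    have hcard := sum_card_nearPoints_le hs1 hSK hδ hsep α hσ hT
    have hreal : (δ / 2) ^ r * η * ε *
          ((w * σ ^ r / ε) ^ q - (nearPoints K α T (δ * σ / 2)).card)
        ≤ ∑ i, (δ / 2) ^ r * η * ε * ((w * p i * (σ * s i) ^ r / ε) ^ q -
          (nearPoints K α (T ∘ S i) (δ * (σ * s i) / 2)).card) := by
      rw [← Finset.mul_sum, Finset.sum_sub_distrib]
      refine mul_le_mul_of_nonneg_left (sub_le_sub (le_of_eq ?_) (by exact_mod_cast hcard)) hcoef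
      have : ∀ i, (w * p i * (σ * s i) ^ r / ε) ^ q
          = (w * σ ^ r / ε) ^ q * (p i * s i ^ r) ^ q := fun i => by
        rw [hwi, ← Real.mul_rpow (by positivity) (weight_pos (hp i) (hs i)).le]
        ring_nf
      simp only [this]
      rw [← Finset.mul_sum, hsum, mul_one]
    refine (ENNReal.ofReal_le_ofReal hreal).trans ((ofReal_sum_le _ _).trans ?_)
    refine (Finset.sum_le_sum fun i _ => hIH i).trans ?_
    rw [lintegral_of_eq_add_sum hScont hμ (measurable_infEDist_comp_rpow hTc α)]
    -- The condensation part only adds to the integral and is dropped.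
    refine le_trans ?_ (mul_le_mul_right le_add_self _)
    rw [Finset.mul_sum]
    refine Finset.sum_le_sum fun i _ => ?_
    rw [ENNReal.ofReal_mul hw.le, mul_assoc]
    rfl

/-- The lower bound `V_{n,r}(μ) ≥ c n ^ (-r / k)`, with `q = k / (r + k)`. -/
lemma exists_le_quantError (hr : 0 < r) {N : ℕ} {S : Fin N → E → E} {s p : Fin N → ℝ}
    (hScont : ∀ i, Continuous (S i)) (hs : ∀ i, 0 < s i) (hs1 : ∀ i, s i < 1)
    (hS : ∀ i x y, s i * dist x y ≤ dist (S i x) (S i y)) (hp : ∀ i, 0 < p i)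
    (hp1 : ∀ i, p i ≤ 1)
    {K : Set E} (hK : IsCompact K) (hSK : ∀ i, ∀ x ∈ K, S i x ∈ K)
    (hdisj : ∀ i j, i ≠ j → Disjoint (S i '' K) (S j '' K))
    {m₀ μ : Measure E} [IsProbabilityMeasure μ] (hμK : ∀ᵐ x ∂μ, x ∈ K)
    (hμ : μ = m₀ + ∑ i, ENNReal.ofReal (p i) • μ.map (S i))
    {q : ℝ} (hq : 0 < q) (hsum : ∑ i, (p i * s i ^ r) ^ q = 1) :
    ∃ c > 0, ∀ n : ℕ, 1 ≤ n →
      ENNReal.ofReal (c * (n : ℝ) ^ (1 - 1 / q)) ≤ quantError r μ n := by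
  obtain ⟨δ, hδ, hsep⟩ := exists_forall_le_dist (fun i => hK.image (hScont i)) hdisj
  obtain ⟨η, hη, hη1, hηb⟩ :=
    exists_pos_le_of_pos (fun i => weight_pos (r := r) (hp i) (hs i)) one_pos
  obtain ⟨A, hA, hA1, hbA⟩ := exists_lt_one_of_lt_one
    fun i => (weight_lt hr (hp i) (hs i) (hs1 i)).trans_le (hp1 i)
  refine ⟨(δ / 2) ^ r * η * 2 ^ (-(1 / q)), by positivity, fun n hn => le_iInf₂ fun α hα => ?_⟩
  have hn0 : (0 : ℝ) < n := by exact_mod_cast hn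
  -- Chosen so that `(1 / ε) ^ q = 2 * n`: after subtracting at most `n` near points, `n` remain.
  set ε : ℝ := (2 * n : ℝ) ^ (-(1 / q)) with hεdef
  have hε : 0 < ε := by positivity
  have hε1 : ε ≤ 1 := Real.rpow_le_one_of_one_le_of_nonpos
    (by have : (1 : ℝ) ≤ n := by exact_mod_cast hn
        linarith) (by have : 0 < 1 / q := by positivity
                      linarith)
  obtain ⟨m, hm⟩ := exists_pow_lt_of_lt_one hε hA1
  have h := le_lintegral_piece hr hScont hs hs1 hS hp hSK hδ hsep hμK hμ hq hsum hη hηb hA hbA α hε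
    m (T := id) (σ := 1) (w := 1) continuous_id one_pos one_pos (by simp)
    (by rw [Real.one_rpow, mul_one]; exact mul_le_one₀ hη1 hε.le hε1) (by simpa using hm)
  simp only [Real.one_rpow, mul_one, ENNReal.ofReal_one, one_mul, id_eq] at h
  refine (ENNReal.ofReal_le_ofReal ?_).trans h
  have e1 : (1 / ε) ^ q = 2 * n := by
    rw [hεdef, Real.rpow_neg (by positivity), one_div, inv_inv, ← Real.rpow_mul (by positivity),
      one_div_mul_cancel hq.ne', Real.rpow_one]
  have hcard : ((nearPoints K α id (δ / 2)).card : ℝ) ≤ n := by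
    have : (nearPoints K α id (δ / 2)).card ≤ α.card := Finset.card_le_card fun a ha => (mem_nearPoints.1 ha).1
    exact_mod_cast this.trans hα
  rw [e1]
  calc (δ / 2) ^ r * η * 2 ^ (-(1 / q)) * (n : ℝ) ^ (1 - 1 / q)
      = (δ / 2) ^ r * η * ε * n := by
        rw [hεdef, Real.mul_rpow (by norm_num) hn0.le, sub_eq_neg_add, Real.rpow_add hn0,
          Real.rpow_one]
        ring
    _ ≤ _ := by gcongr; linarith

end Lower

/-! ### The upper bound -/

section Upper
variable {E : Type*} [NormedAddCommGroup E] [MeasurableSpace E] {r : ℝ}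

/-- Every sufficiently large contracted copy `w • m.map T` of `m` can be quantized at scale `ε` with
`O(x ^ Q)` points and error `O(ε x ^ Q)`, where `x = w σ ^ r / ε` and `σ` is a Lipschitz constant
of `T`. -/
def HasQuantizers (r Q : ℝ) (m : Measure E) : Prop :=
  ∀ η > 0, ∃ B > 0, ∀ (T : E → E) (σ w ε : ℝ), 0 < σ → 0 < w → 0 < ε →
    (∀ x y, dist (T x) (T y) ≤ σ * dist x y) → η * ε ≤ w * σ ^ r →
    ∃ α : Finset E, (α.card : ℝ) ≤ B * (w * σ ^ r / ε) ^ Q ∧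
      ENNReal.ofReal w * ∫⁻ x, (Metric.infEDist (T x) (α : Set E)) ^ r ∂m
        ≤ ENNReal.ofReal (B * ε * (w * σ ^ r / ε) ^ Q)

lemma HasQuantizers.zero (r Q : ℝ) : HasQuantizers r Q (0 : Measure E) :=
  fun _ _ => ⟨1, one_pos, fun _ _ _ _ _ _ _ _ _ => ⟨∅, by simp; positivity, by simp⟩⟩

lemma HasQuantizers.smul {Q : ℝ} {m : Measure E} (hm : HasQuantizers r Q m) {a : ℝ≥0∞}
    (ha : a ≤ 1) : HasQuantizers r Q (a • m) := by
  intro η hη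
  obtain ⟨B, hB, h⟩ := hm η hη
  refine ⟨B, hB, fun T σ w ε hσ hw hε hT h1 => ?_⟩
  obtain ⟨α, hα, h2⟩ := h T σ w ε hσ hw hε hT h1
  refine ⟨α, hα, le_trans ?_ h2⟩
  rw [lintegral_smul_measure, smul_eq_mul]
  gcongr
  exact mul_le_of_le_one_left zero_le ha

/-- Apply the property to `m` itself and choose `ε` so that the allowed number of points `B * ε ^
(-Q)` is exactly `n`; `n ≥ B` ensures `ε ≤ 1`. -/
lemma HasQuantizers.exists_quantError_le {Q : ℝ} (hQ : 0 < Q) {m : Measure E}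
    (hm : HasQuantizers r Q m) :
    ∃ B > 0, ∀ᶠ n : ℕ in atTop, (quantError r m n).toReal ≤ B * (n : ℝ) ^ (1 - 1 / Q) := by
  obtain ⟨B, hB, h⟩ := hm 1 one_pos
  refine ⟨B * B ^ (1 / Q - 1), by positivity, ?_⟩
  filter_upwards [eventually_ge_atTop 1, eventually_ge_atTop ⌈B⌉₊] with n hn1 hnB
  have hn0 : (0 : ℝ) < n := by exact_mod_cast hn1
  have hnB : B ≤ n := Nat.ceil_le.1 hnB
  set ε : ℝ := (n / B) ^ (-(1 / Q)) with hεdef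
  have hε : 0 < ε := by positivity
  have hε1 : ε ≤ 1 := Real.rpow_le_one_of_one_le_of_nonpos ((one_le_div hB).2 hnB)
    (by have : 0 < 1 / Q := by positivity
        linarith)
  obtain ⟨α, hα, hI⟩ := h id 1 1 ε one_pos one_pos hε (by simp) (by simpa using hε1)
  have e1 : (1 / ε) ^ Q = n / B := by
    rw [hεdef, Real.rpow_neg (by positivity), one_div, inv_inv, ← Real.rpow_mul (by positivity),
      one_div_mul_cancel hQ.ne', Real.rpow_one]
  simp only [Real.one_rpow, mul_one, ENNReal.ofReal_one, one_mul, id_eq, e1] at hα hI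
  rw [mul_div_cancel₀ _ hB.ne'] at hα
  have h2 := (quantError_le_lintegral m (by exact_mod_cast hα)).trans hI
  refine (ENNReal.toReal_le_of_le_ofReal (by positivity) h2).trans (le_of_eq ?_)
  rw [hεdef, Real.div_rpow hn0.le hB.le, sub_eq_neg_add 1 (1 / Q), Real.rpow_add hn0,
    sub_eq_add_neg (1 / Q) 1, Real.rpow_add hB, Real.rpow_neg hB.le, Real.rpow_neg hB.le,
    Real.rpow_one, Real.rpow_one]
  field_simp

lemma lintegral_edist_rpow_lt_top (hr : 0 < r) {P : Measure E} [IsProbabilityMeasure P] {K : Set E}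
    (hK : IsCompact K) (hPK : ∀ᵐ x ∂P, x ∈ K) : ∫⁻ x, (edist x 0) ^ r ∂P < ∞ := by
  obtain ⟨R, hR⟩ := hK.isBounded.subset_closedBall 0
  refine lt_of_le_of_lt (b := ENNReal.ofReal R ^ r) ?_
    (ENNReal.rpow_lt_top_of_nonneg hr.le ENNReal.ofReal_ne_top)
  calc ∫⁻ x, (edist x 0) ^ r ∂P ≤ ∫⁻ _, ENNReal.ofReal R ^ r ∂P := by
        refine lintegral_mono_ae ?_
        filter_upwards [hPK] with x hx
        refine ENNReal.rpow_le_rpow ?_ hr.le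
        rw [edist_dist]
        exact ENNReal.ofReal_le_ofReal (hR hx)
    _ = _ := by simp

variable [BorelSpace E]

/-- With `L = ∑ (p i * c i ^ r) ^ Q < 1`, splitting a copy costs `B₀` for its `m₀` part and `B * L`
for its children, relative to `(w σ ^ r / ε) ^ Q`. A constant with `B₀ + B * L ≤ B` therefore
survives the induction; no separation is needed. -/
lemma HasQuantizers.of_eq_add_sum (hr : 0 < r) {Q : ℝ} (hQ : 0 < Q) {N : ℕ} {S : Fin N → E → E}
    {c p : Fin N → ℝ} (hc : ∀ i, 0 < c i) (hc1 : ∀ i, c i < 1)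
    (hS : ∀ i x y, dist (S i x) (S i y) ≤ c i * dist x y) (hp : ∀ i, 0 < p i) (hp1 : ∀ i, p i ≤ 1)
    {m₀ m : Measure E} (hm : m = m₀ + ∑ i, ENNReal.ofReal (p i) • m.map (S i))
    (hmom : ∫⁻ x, (edist x 0) ^ r ∂m < ∞)
    (hsum : ∑ i, (p i * c i ^ r) ^ Q < 1) (hm₀ : HasQuantizers r Q m₀) :
    HasQuantizers r Q m := by
  classical
  intro η₀ hη₀
  have hScont : ∀ i, Continuous (S i) := fun i =>
    (LipschitzWith.of_dist_le_mul (K := ⟨c i, (hc i).le⟩) (hS i)).continuous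
  obtain ⟨η₁, hη₁, hη₁₀, hη₁b⟩ :=
    exists_pos_le_of_pos (fun i => weight_pos (r := r) (hp i) (hc i)) hη₀
  obtain ⟨A, hA, hA1, hbA⟩ := exists_lt_one_of_lt_one
    fun i => (weight_lt hr (hp i) (hc i) (hc1 i)).trans_le (hp1 i)
  obtain ⟨η, hη, hηle, hη1⟩ : ∃ η > 0, η ≤ η₁ ∧ η ≤ 1 :=
    ⟨min η₁ 1, by positivity, min_le_left _ _, min_le_right _ _⟩
  have hηb : ∀ i, η ≤ p i * c i ^ r := fun i => hηle.trans (hη₁b i)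
  obtain ⟨B₀, hB₀, h₀⟩ := hm₀ η hη
  set L := ∑ i, (p i * c i ^ r) ^ Q with hL
  have hL0 : 0 ≤ L :=
    Finset.sum_nonneg fun i _ => Real.rpow_nonneg (weight_pos (hp i) (hc i)).le _
  set R := (∫⁻ x, (edist x 0) ^ r ∂m).toReal with hR
  have hR0 : 0 ≤ R := ENNReal.toReal_nonneg
  -- The first summand sums the geometric series; the second pays for a final copy: one point and an
  -- error governed by the moment `R`.
  set B := B₀ / (1 - L) + (1 + R) * η ^ (-Q) with hBdef
  have h1L : 0 < 1 - L := by linarith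
  have hB : 0 < B := by positivity
  have hBL : B₀ + B * L ≤ B := by
    have h1 : B₀ = B₀ / (1 - L) * (1 - L) := by field_simp
    have h2 : 0 ≤ (1 + R) * η ^ (-Q) * (1 - L) := by positivity
    nlinarith
  have hBη : (1 + R) ≤ B * η ^ Q := by
    have h1 : (1 + R) * η ^ (-Q) * η ^ Q = 1 + R := by
      rw [mul_assoc, ← Real.rpow_add hη]; simp
    have h2 : 0 ≤ B₀ / (1 - L) * η ^ Q := by positivity
    rw [hBdef, add_mul, h1]
    linarith
  have small : ∀ (T : E → E) (σ w ε : ℝ), 0 < σ → 0 < w → 0 < ε →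
      (∀ x y, dist (T x) (T y) ≤ σ * dist x y) → η * ε ≤ w * σ ^ r → w * σ ^ r < ε →
      ∃ α : Finset E, (α.card : ℝ) ≤ B * (w * σ ^ r / ε) ^ Q ∧
        ENNReal.ofReal w * ∫⁻ x, (Metric.infEDist (T x) (α : Set E)) ^ r ∂m
          ≤ ENNReal.ofReal (B * ε * (w * σ ^ r / ε) ^ Q) := by
    intro T σ w ε hσ hw hε hT h1 h2
    have hσr : 0 < σ ^ r := Real.rpow_pos_of_pos hσ r
    have h3 : 1 + R ≤ B * (w * σ ^ r / ε) ^ Q := by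
      refine hBη.trans ?_
      gcongr
      rwa [le_div_iff₀ hε]
    refine ⟨{T 0}, by simpa using by linarith, ?_⟩
    calc ENNReal.ofReal w * ∫⁻ x, (Metric.infEDist (T x) (({T 0} : Finset E) : Set E)) ^ r ∂m
        ≤ ENNReal.ofReal w * ∫⁻ x, ENNReal.ofReal (σ ^ r) * (edist x 0) ^ r ∂m := by
          gcongr with x
          rw [← ENNReal.ofReal_rpow_of_pos hσ, ← ENNReal.mul_rpow_of_nonneg _ _ hr.le]
          gcongr
          simp only [Finset.coe_singleton, Metric.infEDist_singleton]
          rw [edist_dist, edist_dist, ← ENNReal.ofReal_mul hσ.le]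
          exact ENNReal.ofReal_le_ofReal (hT x 0)
      _ = ENNReal.ofReal (w * σ ^ r * R) := by
          rw [lintegral_const_mul' _ _ ENNReal.ofReal_ne_top, ← ENNReal.ofReal_toReal hmom.ne,
            ← mul_assoc, ← ENNReal.ofReal_mul hw.le, ← ENNReal.ofReal_mul (by positivity)]
      _ ≤ _ := by
          refine ENNReal.ofReal_le_ofReal ?_
          calc w * σ ^ r * R ≤ ε * (B * (w * σ ^ r / ε) ^ Q) := by
                apply mul_le_mul h2.le (by linarith) hR0 hε.le
            _ = _ := by ring
  have main : ∀ (k : ℕ) (T : E → E) (σ w ε : ℝ), 0 < σ → 0 < w → 0 < ε →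
      (∀ x y, dist (T x) (T y) ≤ σ * dist x y) → η * ε ≤ w * σ ^ r → w * σ ^ r * A ^ k < ε →
      ∃ α : Finset E, (α.card : ℝ) ≤ B * (w * σ ^ r / ε) ^ Q ∧
        ENNReal.ofReal w * ∫⁻ x, (Metric.infEDist (T x) (α : Set E)) ^ r ∂m
          ≤ ENNReal.ofReal (B * ε * (w * σ ^ r / ε) ^ Q) := by
    intro k
    induction k with
    | zero =>
      intro T σ w ε hσ hw hε hT h1 h2
      exact small T σ w ε hσ hw hε hT h1 (by simpa using h2)
    | succ k ih =>
      intro T σ w ε hσ hw hε hT h1 h2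
      rcases lt_or_ge (w * σ ^ r) ε with hlt | hge
      · exact small T σ w ε hσ hw hε hT h1 hlt
      have hσr : 0 < σ ^ r := Real.rpow_pos_of_pos hσ r
      have hTc : Continuous T :=
        (LipschitzWith.of_dist_le_mul (K := ⟨σ, hσ.le⟩) hT).continuous
      have hwi : ∀ i, w * p i * (σ * c i) ^ r = w * σ ^ r * (p i * c i ^ r) := fun i => by
        rw [Real.mul_rpow hσ.le (hc i).le]; ring
      obtain ⟨α₀, hα₀, hI₀⟩ := h₀ T σ w ε hσ hw hε hT h1
      have hIH : ∀ i, ∃ α : Finset E, (α.card : ℝ) ≤ B * (w * p i * (σ * c i) ^ r / ε) ^ Q ∧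
          ENNReal.ofReal (w * p i) * ∫⁻ x, (Metric.infEDist ((T ∘ S i) x) (α : Set E)) ^ r ∂m
            ≤ ENNReal.ofReal (B * ε * (w * p i * (σ * c i) ^ r / ε) ^ Q) := by
        intro i
        refine ih (T ∘ S i) (σ * c i) (w * p i) ε (mul_pos hσ (hc i)) (mul_pos hw (hp i)) hε ?_ ?_ ?_
        · intro x y
          calc dist (T (S i x)) (T (S i y)) ≤ σ * dist (S i x) (S i y) := hT _ _
            _ ≤ σ * (c i * dist x y) := by gcongr; exact hS i x y
            _ = _ := by ring
        · rw [hwi, mul_comm η]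
          exact mul_le_mul hge (hηb i) hη.le (by positivity)
        · rw [hwi]
          calc w * σ ^ r * (p i * c i ^ r) * A ^ k ≤ w * σ ^ r * A * A ^ k := by
                gcongr; exact hbA i
            _ = w * σ ^ r * A ^ (k + 1) := by ring
            _ < ε := h2
      choose β hβ hI using hIH
      set X := (w * σ ^ r / ε) ^ Q with hX
      have hX0 : 0 ≤ X := by positivity
      have hXi : ∀ i, (w * p i * (σ * c i) ^ r / ε) ^ Q = X * (p i * c i ^ r) ^ Q := fun i => by
        rw [hwi, hX, ← Real.mul_rpow (by positivity) (weight_pos (hp i) (hc i)).le]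
        ring_nf
      simp only [hXi] at hβ hI
      have hBX : (B₀ + B * L) * X ≤ B * X := by gcongr
      -- Pool the points for the `m₀` part with those of the children; enlarging a set only
      -- decreases distances to it.
      refine ⟨α₀ ∪ Finset.univ.biUnion β, ?_, ?_⟩
      · have hcard : (α₀ ∪ Finset.univ.biUnion β).card ≤ α₀.card + ∑ i, (β i).card :=
          (Finset.card_union_le _ _).trans (by gcongr; exact Finset.card_biUnion_le)
        calc ((α₀ ∪ Finset.univ.biUnion β).card : ℝ) ≤ α₀.card + ∑ i, ((β i).card : ℝ) := by
              exact_mod_cast hcard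
          _ ≤ B₀ * X + ∑ i, B * (X * (p i * c i ^ r) ^ Q) := by
              gcongr with i
              exact hβ i
          _ = (B₀ + B * L) * X := by
              rw [← Finset.mul_sum, ← Finset.mul_sum]; ring
          _ ≤ _ := hBX
      · rw [lintegral_of_eq_add_sum hScont hm (measurable_infEDist_comp_rpow hTc _), mul_add,
          Finset.mul_sum]
        have hsub : ∀ i, (β i : Set E) ⊆ ((α₀ ∪ Finset.univ.biUnion β : Finset E) : Set E) :=
          fun i => Finset.coe_subset.2 ((Finset.subset_biUnion_of_mem β (Finset.mem_univ i)).trans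
            Finset.subset_union_right)
        have hsub₀ : (α₀ : Set E) ⊆ ((α₀ ∪ Finset.univ.biUnion β : Finset E) : Set E) :=
          Finset.coe_subset.2 Finset.subset_union_left
        calc _ ≤ ENNReal.ofReal (B₀ * ε * X)
              + ∑ i, ENNReal.ofReal (B * ε * (X * (p i * c i ^ r) ^ Q)) := by
              gcongr with i
              · refine le_trans ?_ hI₀
                gcongr with x
              · refine le_trans ?_ (hI i)
                rw [ENNReal.ofReal_mul hw.le, mul_assoc]
                gcongr with x
                exact Metric.infEDist_anti (hsub i)
          _ = ENNReal.ofReal ((B₀ + B * L) * X * ε) := by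
              have hnn : ∀ i, 0 ≤ B * ε * (X * (p i * c i ^ r) ^ Q) := fun i => by
                have := Real.rpow_nonneg (weight_pos (r := r) (hp i) (hc i)).le Q
                positivity
              rw [← ENNReal.ofReal_sum_of_nonneg fun i _ => hnn i,
                ← ENNReal.ofReal_add (by positivity) (Finset.sum_nonneg fun i _ => hnn i),
                ← Finset.mul_sum, ← Finset.mul_sum]
              congr 1
              ring
          _ ≤ _ := ENNReal.ofReal_le_ofReal (by
              calc (B₀ + B * L) * X * ε ≤ B * X * ε := by gcongr
                _ = _ := by ring)
  refine ⟨B, hB, fun T σ w ε hσ hw hε hT h1 => ?_⟩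
  have hσr : 0 < σ ^ r := Real.rpow_pos_of_pos hσ r
  obtain ⟨k, hk⟩ := exists_pow_lt_of_lt_one (show 0 < ε / (w * σ ^ r) by positivity) hA1
  refine main k T σ w ε hσ hw hε hT (le_trans ?_ h1) ?_
  · gcongr
    exact hηle.trans hη₁₀
  · rwa [lt_div_iff₀ (by positivity), mul_comm] at hk

end Upper

/-! ### Comparison of dimensions -/

section Main
variable {E : Type*} [NormedAddCommGroup E] [MeasurableSpace E] {r : ℝ}

lemma quantRatio_nonneg (hr : 0 < r) {P : Measure E} {n : ℕ}
    (h : (quantError r P n).toReal < 1) : 0 ≤ quantRatio r P n :=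
  div_nonneg (mul_nonneg hr.le (Real.log_natCast_nonneg n))
    (neg_nonneg.2 (Real.log_nonpos ENNReal.toReal_nonneg h.le))

lemma lowerQuantDim_nonneg (hr : 0 < r) {P : Measure E}
    (h : ∀ᶠ n in atTop, (quantError r P n).toReal < 1) : 0 ≤ lowerQuantDim r P := by
  refine le_liminf_of_le (by isBoundedDefault) ?_
  filter_upwards [h] with n hn
  exact_mod_cast quantRatio_nonneg hr hn

lemma quantError_ne_top_of_compact (hr : 0 < r) {P : Measure E} [IsProbabilityMeasure P]
    {K : Set E} (hK : IsCompact K) (hPK : ∀ᵐ x ∂P, x ∈ K) {n : ℕ} (hn : 1 ≤ n) :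
    quantError r P n ≠ ∞ := by
  refine ((quantError_le_lintegral P (α := {0}) (by simpa using hn)).trans_lt ?_).ne
  simpa using lintegral_edist_rpow_lt_top hr hK hPK

/-- Quantization dimensions are monotone under domination up to a constant. -/
lemma lowerQuantDim_mono (hr : 0 < r) {ν μ : Measure E} [IsProbabilityMeasure μ] {a : ℝ}
    (ha : 0 < a) (h : ENNReal.ofReal a • ν ≤ μ) {K : Set E} (hK : IsCompact K)
    (hμK : ∀ᵐ x ∂μ, x ∈ K) : lowerQuantDim r ν ≤ lowerQuantDim r μ := by
  have h1 := eventually_quantError_lt_one hr hK hμK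
  refine EReal.ge_of_forall_gt_iff_ge.1 fun z hz => ?_
  rcases le_or_gt z 0 with hz0 | hz0
  · exact (EReal.coe_nonpos.2 hz0).trans (lowerQuantDim_nonneg hr h1)
  refine le_lowerQuantDim hr h1 (b := z * -Real.log a) ?_
  filter_upwards [eventually_lt_of_lt_liminf hz (by isBoundedDefault), h1,
    eventually_ge_atTop 1] with n hn hn1 hn2
  have hn : z < quantRatio r ν n := by exact_mod_cast hn
  have hL : 0 ≤ r * Real.log n := mul_nonneg hr.le (Real.log_natCast_nonneg n)
  rw [quantRatio] at hn
  have hpos : 0 < -Real.log (quantError r ν n).toReal := by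
    by_contra hcon
    linarith [div_nonpos_of_nonneg_of_nonpos hL (not_lt.1 hcon)]
  rw [lt_div_iff₀ hpos] at hn
  -- A vanishing error would make the quotient `0`, contradicting `z > 0`.
  have hV0 : 0 < (quantError r ν n).toReal := by
    refine ENNReal.toReal_nonneg.lt_of_ne fun h0 => ?_
    rw [← h0] at hpos
    simp at hpos
  have hle : a * (quantError r ν n).toReal ≤ (quantError r μ n).toReal := by
    have := ENNReal.toReal_mono (quantError_ne_top_of_compact hr hK hμK hn2)
      (smul_quantError_le (r := r) h n)
    rwa [ENNReal.toReal_mul, ENNReal.toReal_ofReal ha.le] at this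
  have hlog := Real.log_le_log (mul_pos ha hV0) hle
  rw [Real.log_mul ha.ne' hV0.ne'] at hlog
  refine ⟨(mul_pos ha hV0).trans_le hle, ?_⟩
  have := mul_le_mul_of_nonneg_left hlog hz0.le
  linarith

/-- A power lower bound for the quantization error bounds the lower dimension below. -/
lemma le_lowerQuantDim_of_rpow_le (hr : 0 < r) {μ : Measure E} [IsProbabilityMeasure μ] {K : Set E}
    (hK : IsCompact K) (hμK : ∀ᵐ x ∂μ, x ∈ K) {k c : ℝ} (hk : 0 < k) (hc : 0 < c)
    (h : ∀ n : ℕ, 1 ≤ n →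
      ENNReal.ofReal (c * (n : ℝ) ^ (1 - 1 / (k / (r + k)))) ≤ quantError r μ n) :
    (k : EReal) ≤ lowerQuantDim r μ := by
  refine le_lowerQuantDim hr (eventually_quantError_lt_one hr hK hμK) (b := k * -Real.log c) ?_
  filter_upwards [eventually_ge_atTop 1] with n hn
  have hn0 : (0 : ℝ) < n := by exact_mod_cast hn
  have hle := (ENNReal.ofReal_le_iff_le_toReal (quantError_ne_top_of_compact hr hK hμK hn)).1 (h n hn)
  have hpos : 0 < c * (n : ℝ) ^ (1 - 1 / (k / (r + k))) := by positivity
  refine ⟨hpos.trans_le hle, ?_⟩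
  have hlog := Real.log_le_log hpos hle
  rw [Real.log_mul hc.ne' (by positivity), Real.log_rpow hn0] at hlog
  have e : k * (1 - 1 / (k / (r + k))) = -r := by field_simp; ring
  have := mul_le_mul_of_nonneg_left hlog hk.le
  rw [mul_add, ← mul_assoc, e] at this
  linarith

end Main
end CondQuant

/-! ### Assembly of the two bounds -/

open CondQuant

theorem theorem1p1 {E : Type*} [NormedAddCommGroup E] [NormedSpace ℝ E] [FiniteDimensional ℝ E]
    [MeasurableSpace E] [BorelSpace E]
    (r : ℝ) (hr : 0 < r)
    (N : ℕ) (hN : 1 ≤ N) (S : Fin N → E → E) (s c : Fin N → ℝ)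
    (hs : ∀ i, 0 < s i) (hsc : ∀ i, s i ≤ c i) (hc : ∀ i, c i < 1)
    (hS : ∀ i x y, s i * dist x y ≤ dist (S i x) (S i y) ∧ dist (S i x) (S i y) ≤ c i * dist x y)
    (p : Fin (N + 1) → ℝ) (hp : CondQuant.IsProbVector p)
    (C : Set E) (hC : IsCompact C)
    (ν : MeasureTheory.Measure E) [MeasureTheory.IsProbabilityMeasure ν] (hν : ν C = 1)
    (μ : MeasureTheory.Measure E) [MeasureTheory.IsProbabilityMeasure μ]
    (hμ : CondQuant.IsCondensationMeasure S p ν μ)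
    (hsep : CondQuant.StrongSeparation S C) :
    ((∃! k : ℝ, CondQuant.IsDimSolution r (fun i => p i.succ) s k) ∧
      ∀ k : ℝ, CondQuant.IsDimSolution r (fun i => p i.succ) s k →
        max (k : EReal) (CondQuant.lowerQuantDim r ν) ≤ CondQuant.lowerQuantDim r μ) ∧
    ∀ (M : ℕ) (g : Fin M → E → E) (ρ t : Fin M → ℝ),
      (∀ j, 0 < ρ j ∧ ρ j < 1) →
      (∀ j x y, dist (g j x) (g j y) ≤ ρ j * dist x y) →
      CondQuant.StrongOpenSetCondition g →
      CondQuant.IsProbVector t →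
      CondQuant.IsInvariantMeasure g t ν →
      (∃! l : ℝ, CondQuant.IsDimSolution r (fun i => p i.succ) c l) ∧
      (∃! d : ℝ, CondQuant.IsDimSolution r t ρ d) ∧
      ∀ l d : ℝ, CondQuant.IsDimSolution r (fun i => p i.succ) c l →
        CondQuant.IsDimSolution r t ρ d →
        CondQuant.upperQuantDim r μ ≤ max (l : EReal) (d : EReal) := by
  have hc0 : ∀ i, 0 < c i := fun i => (hs i).trans_le (hsc i)
  have hs1 : ∀ i, s i < 1 := fun i => (hsc i).trans_lt (hc i)
  have hp0 : ∀ i : Fin N, 0 < p i.succ := fun i => hp.1 _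
  have hpsum : ∑ i : Fin N, p i.succ ≤ 1 := by
    have h := hp.2
    rw [Fin.sum_univ_succ] at h
    linarith [hp.1 0]
  have hp1 : ∀ i : Fin N, p i.succ ≤ 1 := fun i =>
    (Finset.single_le_sum (f := fun i : Fin N => p i.succ) (fun j _ => (hp0 j).le)
      (Finset.mem_univ i)).trans hpsum
  have hScont : ∀ i, Continuous (S i) := fun i =>
    (LipschitzWith.of_dist_le_mul (K := ⟨c i, (hc0 i).le⟩) fun x y => (hS i x y).2).continuous
  have hνC : ∀ᵐ x ∂ν, x ∈ C := (prob_compl_eq_zero_iff hC.isClosed.measurableSet).2 hν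
  obtain ⟨K, hK, hdisj, -⟩ := hsep
  have hμK := ae_mem_attractor hScont hp hνC hμ hK
  have hSK : ∀ i, ∀ x ∈ K, S i x ∈ K := fun i x hx => by
    rw [hK.2]
    exact Or.inl (Set.mem_iUnion.2 ⟨i, x, hx, rfl⟩)
  refine ⟨⟨existsUnique_isDimSolution hN hr hp0 hpsum hs hs1, fun k hk => max_le ?_ ?_⟩, ?_⟩
  -- For `k = 0` the exponent `q` is `0`, outside the reach of `exists_le_quantError`; nonnegativity
  -- of the dimension suffices.
  · rcases hk.1.eq_or_lt with h0 | h0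
    · rw [← h0]
      exact lowerQuantDim_nonneg hr (eventually_quantError_lt_one hr hK.1 hμK)
    · obtain ⟨a, ha, h⟩ := exists_le_quantError hr hScont hs hs1 (fun i x y => (hS i x y).1) hp0 hp1
        hK.1 hSK hdisj hμK hμ (show 0 < k / (r + k) by positivity) hk.2
      exact le_lowerQuantDim_of_rpow_le hr hK.1 hμK h0 ha h
  · refine lowerQuantDim_mono hr (hp.1 0) ?_ hK.1 hμK
    conv_rhs => rw [hμ]
    exact Measure.le_add_right le_rfl
  · intro M g ρ t hρ hg _ ht hνg
    have hM : 1 ≤ M := by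
      rcases Nat.eq_zero_or_pos M with h0 | h0
      · subst h0
        simpa using ht.2
      · exact h0
    have ht1 : ∀ j, t j ≤ 1 := fun j => ht.2 ▸
      Finset.single_le_sum (fun j _ => (ht.1 j).le) (Finset.mem_univ j)
    refine ⟨existsUnique_isDimSolution hN hr hp0 hpsum hc0 hc,
      existsUnique_isDimSolution hM hr ht.1 ht.2.le (fun j => (hρ j).1) fun j => (hρ j).2,
      fun l d hl hd => ?_⟩
    -- Working with `D` strictly above `l` and `d` makes both sums strictly less than one.
    refine EReal.le_of_forall_lt_iff_le.1 fun D hD => ?_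
    obtain ⟨hlD, hdD⟩ := max_lt_iff.1 hD
    have hlD : l < D := by exact_mod_cast hlD
    have hdD : d < D := by exact_mod_cast hdD
    have hD0 : 0 < D := hl.1.trans_lt hlD
    have hQ : 0 < D / (r + D) := by positivity
    have hsumμ : ∑ i : Fin N, (p i.succ * c i ^ r) ^ (D / (r + D)) < 1 :=
      (sum_rpow_strictAnti hN (fun i => weight_pos (hp0 i) (hc0 i))
        (fun i => (weight_lt hr (hp0 i) (hc0 i) (hc i)).trans_le (hp1 i))
        (exponent_strictMono hr hl.1 hlD)).trans_eq hl.2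
    have hsumν : ∑ j, (t j * ρ j ^ r) ^ (D / (r + D)) < 1 :=
      (sum_rpow_strictAnti hM (fun j => weight_pos (ht.1 j) (hρ j).1)
        (fun j => (weight_lt hr (ht.1 j) (hρ j).1 (hρ j).2).trans_le (ht1 j))
        (exponent_strictMono hr hd.1 hdD)).trans_eq hd.2
    -- Self-similarity of `ν` is the case of a zero condensation part.
    have hQν : HasQuantizers r (D / (r + D)) ν :=
      .of_eq_add_sum hr hQ (fun j => (hρ j).1) (fun j => (hρ j).2) hg ht.1 ht1
        (by rw [zero_add]; exact hνg) (lintegral_edist_rpow_lt_top hr hC hνC) hsumν (.zero _ _)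
    have hp01 : ENNReal.ofReal (p 0) ≤ 1 := by
      rw [ENNReal.ofReal_le_one, ← hp.2]
      exact Finset.single_le_sum (fun j _ => (hp.1 j).le) (Finset.mem_univ 0)
    have hQμ : HasQuantizers r (D / (r + D)) μ :=
      .of_eq_add_sum hr hQ hc0 hc (fun i x y => (hS i x y).2) hp0 hp1 hμ
        (lintegral_edist_rpow_lt_top hr hK.1 hμK) hsumμ (hQν.smul hp01)
    obtain ⟨B, hB, h⟩ := hQμ.exists_quantError_le hQ
    have e : 1 - 1 / (D / (r + D)) = -(r / D) := by field_simp; ring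
    rw [e] at h
    exact upperQuantDim_le hD0 hr hB h
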